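/- Let $\Omega\subset\mathbb R^n$ be a bounded Lipschitz domain. For $s\in\mathbb R$ let $H^s=H^s(\Omega)$ be the real Sobolev space of restrictions to $\Omega$ of elements of $H^s(\mathbb R^n)$, with the quotient norm, and for a finite-dimensional real inner product space $\mathbb W$ let $\|\cdot\|_s$ denote the Hilbert norm of the space $H^s\otimes\mathbb W$ of $\mathbb W$-valued distributions with components in $H^s$. For each $k\in\mathbb Z$ let $\mathbb W^k$ be a finite-dimensional real inner product space, $\gamma_k\ge 1$ a real number, and $D^k$ a linear differential operator on $\Omega$ of order at most $\gamma_k$ with smooth coefficients, taking $\mathbb W^k$-valued distributions on $\Omega$ to $\mathbb W^{k+1}$-valued ones. For $q\in\mathbb R$ define $q_k$, $k\in\mathbb Z$, by $q_0=q$ and $q_{k+1}=q_k-\gamma_k$. Suppose that for every $q\in\mathbb R$ the sequence $$\cdots\to H^{q_k}\otimes\mathbb W^k\xrightarrow{D^k}H^{q_{k+1}}\otimes\mathbb W^{k+1}\to\cdots$$ is a complex (that is, $D^k$ maps $H^{q_k}\otimes\mathbb W^k$ into $H^{q_{k+1}}\otimes\mathbb W^{k+1}$ and $D^{k+1}D^k=0$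 on $H^{q_k}\otimes\mathbb W^k$). Suppose also that this Sobolev scale of complexes has a uniform representation of cohomology: there are finite-dimensional spaces $G^k_\infty\subset L^2(\Omega)\otimes\mathbb W^k$, independent of $q$, such that for all $k\in\mathbb Z$ and $q\in\mathbb R$ $$\ker(D^k,\,H^{q_k}\otimes\mathbb W^k)=D^{k-1}(H^{q_{k-1}}\otimes\mathbb W^{k-1})\oplus G^k_\infty .$$ Then for all $q,r\in\mathbb R$ and $k\in\mathbb Z$ there is a constant $C$ such that for every $v\in (H^q\otimes\mathbb W^{k+1})\cap D^k(H^r\otimes\mathbb W^k)$ there exists $u\in H^{q+\gamma_k}\otimes\mathbb W^k$ with $D^ku=v$ and $$\|u\|_{q+\gamma_k}\le C\,\|v\|_q .$$ -/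

import Mathlib

open TopologicalSpace MeasureTheory TemperedDistribution
open scoped Distributions SchwartzMap LineDeriv ContDiff ENNReal CompactConvergenceCLM

noncomputable section

namespace SobolevScale

/-- Euclidean space `ℝⁿ`. -/
abbrev Euc (n : ℕ) : Type := EuclideanSpace ℝ (Fin n)

/-- `Ω ⊆ ℝⁿ` is a bounded Lipschitz domain: a bounded open set such that near every boundary point,
for a suitable unit vector `e` (the "vertical" direction), `Ω` is the set of points lying strictly
below the graph of a Lipschitz function on the hyperplane orthogonal to `e`. -/
def IsBoundedLipschitzDomain {n : ℕ} (Ω : Opens (Euc n)) : Prop :=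
  Bornology.IsBounded (Ω : Set (Euc n)) ∧
    ∀ x ∈ frontier (Ω : Set (Euc n)), ∃ (e : Euc n) (r : ℝ) (K : NNReal)
      (g : (ℝ ∙ e)ᗮ → ℝ), ‖e‖ = 1 ∧ 0 < r ∧ LipschitzWith K g ∧
        ∀ y ∈ Metric.ball x r,
          y ∈ Ω ↔ inner ℝ e y < g ((ℝ ∙ e)ᗮ.orthogonalProjectionOnto y)

section Sobolev

variable {n : ℕ} {Ω : Opens (Euc n)}

/-- A real test function on `Ω`, extended by zero, as a (complex valued) Schwartz function. -/
def toSchwartz (φ : 𝓓(Ω, ℝ)) : 𝓢(Euc n, ℂ) :=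
  HasCompactSupport.toSchwartzMap (f := Complex.ofRealCLM ∘ φ)
    (φ.hasCompactSupport.comp_left (map_zero _))
    (Complex.ofRealCLM.contDiff.comp φ.contDiff)

/-- The tempered distribution `U` on `ℝⁿ` restricts to the real distribution `T` on `Ω`. -/
def RestrictsTo (U : 𝓢'(Euc n, ℂ)) (T : 𝓓'(Ω, ℝ)) : Prop :=
  ∀ φ : 𝓓(Ω, ℝ), U (toSchwartz φ) = ((T φ : ℝ) : ℂ)

theorem RestrictsTo.zero : RestrictsTo (0 : 𝓢'(Euc n, ℂ)) (0 : 𝓓'(Ω, ℝ)) := by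
  intro φ
  simp

theorem RestrictsTo.add {U U' : 𝓢'(Euc n, ℂ)} {T T' : 𝓓'(Ω, ℝ)}
    (h : RestrictsTo U T) (h' : RestrictsTo U' T') : RestrictsTo (U + U') (T + T') := by
  intro φ
  have h1 : (U + U') (toSchwartz φ) = U (toSchwartz φ) + U' (toSchwartz φ) := rfl
  have h2 : (T + T') φ = T φ + T' φ := rfl
  rw [h1, h2, h φ, h' φ]
  push_cast
  rfl

theorem RestrictsTo.smul {U : 𝓢'(Euc n, ℂ)} {T : 𝓓'(Ω, ℝ)} (c : ℝ)
    (h : RestrictsTo U T) : RestrictsTo ((c : ℂ) • U) (c • T) := by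
  intro φ
  have h1 : ((c : ℂ) • U) (toSchwartz φ) = (c : ℂ) * U (toSchwartz φ) := rfl
  have h2 : (c • T) φ = c * T φ := rfl
  rw [h1, h2, h φ]
  push_cast
  rfl

variable (Ω) in
/-- The real scalar Sobolev space `H^s(Ω)`, `s ∈ ℝ`: the distributions on `Ω` that are
restrictions of elements of `H^s(ℝⁿ)`. -/
def scalarSobolev (s : ℝ) : Submodule ℝ 𝓓'(Ω, ℝ) where
  carrier := {T | ∃ U : 𝓢'(Euc n, ℂ), MemSobolev s 2 U ∧ RestrictsTo U T}
  zero_mem' := ⟨0, memSobolev_fun_zero _ _ _ _, RestrictsTo.zero⟩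
  add_mem' := by
    rintro T T' ⟨U, hU, h⟩ ⟨U', hU', h'⟩
    exact ⟨U + U', hU.add hU', h.add h'⟩
  smul_mem' := by
    rintro c T ⟨U, hU, h⟩
    exact ⟨(c : ℂ) • U, hU.smul _, h.smul c⟩

/-- The quotient norm of `H^s(Ω)`: the infimum of the `H^s(ℝⁿ)` norms (the `L²` norm of the Bessel
potential of order `s`) of all extensions. The infimum over complex extensions agrees with the one
over real extensions, as taking real parts does not increase the norm. -/
def scalarSobolevNorm (s : ℝ) (T : 𝓓'(Ω, ℝ)) : ℝ :=
  sInf {c : ℝ | ∃ (U : 𝓢'(Euc n, ℂ)) (f : Lp ℂ 2 (volume : Measure (Euc n))),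
    RestrictsTo U T ∧ besselPotential (Euc n) ℂ s U = (f : 𝓢'(Euc n, ℂ)) ∧ c = ‖f‖}

variable {W : Type*} [NormedAddCommGroup W] [InnerProductSpace ℝ W]

/-- The scalar distribution `⟨w, T⟩` obtained from a `W`-valued distribution `T` on `Ω`. -/
def component (w : W) : 𝓓'(Ω, W) →L[ℝ] 𝓓'(Ω, ℝ) :=
  Distribution.mapCLM (innerSL ℝ w)

variable (Ω W) in
/-- The vector valued Sobolev space `H^s(Ω) ⊗ W` for a finite dimensional inner product space `W`:
all components of the distribution belong to `H^s(Ω)`. -/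
def Sobolev (s : ℝ) : Submodule ℝ 𝓓'(Ω, W) :=
  ⨅ w : W, (scalarSobolev Ω s).comap (component w).toLinearMap

/-- The Hilbert tensor product norm of `H^s(Ω) ⊗ W`, computed in an orthonormal basis of `W`
(it does not depend on the choice of the basis). -/
def sobolevNorm [FiniteDimensional ℝ W] (s : ℝ) (T : 𝓓'(Ω, W)) : ℝ :=
  Real.sqrt (∑ i, scalarSobolevNorm s (component (stdOrthonormalBasis ℝ W i) T) ^ 2)

end Sobolev

section DifferentialOperator

variable {n : ℕ} {Ω : Opens (Euc n)}

theorem contDiff_mul_of_tsupport_subset {c : Euc n → ℝ} (hc : ContDiffOn ℝ ∞ c Ω)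
    {f : Euc n → ℝ} (hf : ContDiff ℝ ∞ f) (hsupp : tsupport f ⊆ Ω) :
    ContDiff ℝ ∞ (fun x ↦ f x * c x) := by
  rw [contDiff_iff_contDiffAt]
  intro x
  by_cases hx : x ∈ Ω
  · exact hf.contDiffAt.mul (hc.contDiffAt (Ω.isOpen.mem_nhds hx))
  · have h0 : f =ᶠ[nhds x] 0 := notMem_tsupport_iff_eventuallyEq.mp fun h ↦ hx (hsupp h)
    refine contDiffAt_const (c := (0 : ℝ)) |>.congr_of_eventuallyEq ?_
    filter_upwards [h0] with y hy
    simp [hy]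

/-- For `c` smooth on `Ω` and `K ⊆ Ω` compact, `c` agrees on `K` with a smooth function
on `ℝⁿ`. -/
theorem exists_smooth_eqOn {c : Euc n → ℝ} (hc : ContDiffOn ℝ ∞ c Ω)
    {K : Compacts (Euc n)} (hK : (K : Set (Euc n)) ⊆ Ω) :
    ∃ g : Euc n → ℝ, ContDiff ℝ ∞ g ∧ ∀ x ∈ K, g x = c x := by
  obtain ⟨L, hL, hKL, hLΩ⟩ := exists_compact_between K.isCompact Ω.isOpen hK
  obtain ⟨f, hf1, hf0, -⟩ := exists_contMDiffMap_one_nhds_of_subset_interior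
    (n := (⊤ : ℕ∞)) (modelWithCornersSelf ℝ (Euc n)) K.isCompact.isClosed hKL
  have hsupp : tsupport (f : Euc n → ℝ) ⊆ Ω := by
    refine (closure_minimal (fun x hx ↦ ?_) hL.isClosed).trans hLΩ
    by_contra hxL
    exact hx (hf0 x hxL)
  refine ⟨fun x ↦ f x * c x, ?_, fun x hx ↦ ?_⟩
  · exact contDiff_mul_of_tsupport_subset hc f.contMDiff.contDiff hsupp
  · have h1 : f x = 1 := hf1.self_of_nhdsSet x hx
    simp [h1]

/-- The product of a function `c` that is smooth on `Ω` with a test function on `Ω`. -/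
def mulTestFun (c : Euc n → ℝ) (hc : ContDiffOn ℝ ∞ c Ω) (φ : 𝓓(Ω, ℝ)) : 𝓓(Ω, ℝ) where
  toFun x := c x * φ x
  contDiff' := by
    simpa only [mul_comm] using
      contDiff_mul_of_tsupport_subset hc φ.contDiff φ.tsupport_subset
  hasCompactSupport' := φ.hasCompactSupport.mul_left
  tsupport_subset' := (tsupport_mul_subset_right).trans φ.tsupport_subset

/-- Multiplication of test functions by a function `c` that is smooth on `Ω`, as a continuous
linear map. -/
def mulTest (c : Euc n → ℝ) (hc : ContDiffOn ℝ ∞ c Ω) : 𝓓(Ω, ℝ) →L[ℝ] 𝓓(Ω, ℝ) :=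
  TestFunction.limitCLM ℝ (mulTestFun c hc)
    (fun K hK ↦ (TestFunction.ofSupportedInCLM ℝ hK).comp
      (ContDiffMapSupportedIn.bilinLeftCLM (ContinuousLinearMap.mul ℝ ℝ)
        (exists_smooth_eqOn hc hK).choose_spec.1))
    (by
      intro K hK f
      ext x
      change c x * f x = f x * (exists_smooth_eqOn hc hK).choose x
      by_cases hx : x ∈ K
      · rw [(exists_smooth_eqOn hc hK).choose_spec.2 x hx, mul_comm]
      · simp [f.zero_on_compl hx])

variable {F : Type*} [NormedAddCommGroup F] [NormedSpace ℝ F]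
  {F' : Type*} [NormedAddCommGroup F'] [NormedSpace ℝ F']

/-- The product `c T` of a distribution `T` on `Ω` with a smooth function `c` on `Ω`:
`(c T)(φ) = T (c φ)`. -/
def smoothMul (c : Euc n → ℝ) (hc : ContDiffOn ℝ ∞ c Ω) (T : 𝓓'(Ω, F)) : 𝓓'(Ω, F) :=
  (mulTest c hc).precompCompactConvergenceCLM F T

/-- Linear differential operators of order at most `γ`, with smooth coefficients on `Ω`, acting on
`F`-valued distributions and with values in `F'`-valued distributions: the finite sums of operators
`T ↦ A (c ∂^m T)`, where `∂^m` is an iterated partial derivative of order `j ≤ γ`, `c` is a smooth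
function on `Ω` and `A : F → F'` is linear. -/
def IsDiffOp (γ : ℝ) (D : 𝓓'(Ω, F) →ₗ[ℝ] 𝓓'(Ω, F')) : Prop :=
  D ∈ Submodule.span ℝ {L : 𝓓'(Ω, F) →ₗ[ℝ] 𝓓'(Ω, F') |
    ∃ (j : ℕ) (m : Fin j → Euc n) (c : Euc n → ℝ) (hc : ContDiffOn ℝ ∞ c Ω) (A : F →L[ℝ] F'),
      (j : ℝ) ≤ γ ∧ ∀ T, L T = Distribution.mapCLM A (smoothMul c hc (∂^{m} T))}

end DifferentialOperator

/-- The Sobolev orders `q_k`, `k ∈ ℤ`, of a scale: `q_0 = q` and `q_{k+1} = q_k - γ_k`. -/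
def order (γ : ℤ → ℝ) (q : ℝ) (k : ℤ) : ℝ :=
  q - ∑ i ∈ Finset.Ico 0 k, γ i + ∑ i ∈ Finset.Ico k 0, γ i

theorem order_zero (γ : ℤ → ℝ) (q : ℝ) : order γ q 0 = q := by
  simp [order]

theorem order_succ (γ : ℤ → ℝ) (q : ℝ) (k : ℤ) : order γ q (k + 1) = order γ q k - γ k := by
  unfold order
  rcases le_or_gt 0 k with hk | hk
  · rw [Finset.Ico_eq_empty_of_le hk, Finset.Ico_eq_empty_of_le (by lia : (0 : ℤ) ≤ k + 1),
      ← Finset.insert_Ico_right_eq_Ico_add_one hk, Finset.sum_insert (by simp)]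
    simp only [Finset.sum_empty]
    ring
  · rw [Finset.Ico_eq_empty_of_le hk.le, Finset.Ico_eq_empty_of_le (by lia : k + 1 ≤ (0 : ℤ)),
      ← Finset.insert_Ico_add_one_left_eq_Ico hk, Finset.sum_insert (by simp)]
    simp only [Finset.sum_empty]
    ring

section Scale

variable {n : ℕ} (Ω : Opens (Euc n)) (W : ℤ → Type*) [∀ k, NormedAddCommGroup (W k)]
  [∀ k, InnerProductSpace ℝ (W k)] (γ : ℤ → ℝ)
  (D : ∀ k, 𝓓'(Ω, W k) →ₗ[ℝ] 𝓓'(Ω, W (k + 1)))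

/-- The sequences `⋯ → H^{q_k} ⊗ W^k → H^{q_{k+1}} ⊗ W^{k+1} → ⋯`, `q ∈ ℝ`, with maps `D^k`, form
a Sobolev scale of complexes. -/
structure IsSobolevScale : Prop where
  one_le_order : ∀ k, 1 ≤ γ k
  isDiffOp : ∀ k, IsDiffOp (γ k) (D k)
  mapsTo : ∀ q k, ∀ u ∈ Sobolev Ω (W k) (order γ q k),
    D k u ∈ Sobolev Ω (W (k + 1)) (order γ q (k + 1))
  complex : ∀ q k, ∀ u ∈ Sobolev Ω (W k) (order γ q k), D (k + 1) (D k u) = 0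

/-- The finite dimensional spaces `G^k ⊆ L²(Ω) ⊗ W^k` uniformly represent the cohomology of the
scale: `ker(D^k, H^{q_k} ⊗ W^k) = ran(D^{k-1}, H^{q_{k-1}} ⊗ W^{k-1}) ⊕ G^k` for all `q` and `k`.
(The condition is written at `k + 1` in place of `k`; `H^0(Ω) = L²(Ω)`.) -/
structure UniformlyRepresentsCohomology (G : ∀ k, Submodule ℝ 𝓓'(Ω, W k)) : Prop where
  finiteDimensional : ∀ k, FiniteDimensional ℝ (G k)
  le_L2 : ∀ k, G k ≤ Sobolev Ω (W k) 0
  disjoint : ∀ (q : ℝ) (k : ℤ),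
    Disjoint ((Sobolev Ω (W k) (order γ q k)).map (D k)) (G (k + 1))
  ker_eq : ∀ (q : ℝ) (k : ℤ),
    Sobolev Ω (W (k + 1)) (order γ q (k + 1)) ⊓ LinearMap.ker (D (k + 1)) =
      (Sobolev Ω (W k) (order γ q k)).map (D k) ⊔ G (k + 1)

end Scale

end SobolevScale

end

noncomputable section

namespace SobolevScale

/-! ### Restriction of tempered distributions to real distributions on `Ω`. -/

section Restriction

variable {n : ℕ} {Ω : Opens (Euc n)}

/-! Let `v = D w` have order `q`, with `w` of order `r`. Then `v` is closed, so the decomposition of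
the kernel at order `q` gives `v = D u + g` with `u` of order `q + γ_k` and `g ∈ G`. Now `g = D (w -
u)` is also exact at the order `min r (q + γ_k)`; as the same `G` is complementary to the exact
elements at every order, `g = 0`. No norm of `w` enters.

The bound on `u` comes from the open mapping theorem. Bessel potentials and restriction parametrize
`H^s ⊗ W` by a Banach space of tuples of `L²` functions, the norms being comparable for a suitable
choice of parameter (`exists_param_eq_norm_le`, `sobolevNorm_param_le`). Differential operators on
parametrized distributions are continuous after evaluation at each test function
(`IsDiffOp.continuous_apply`). This is enough for the solution set of `P x = Q y` to be a Banach
space projecting onto the data (`exists_preimage_norm_le_of_separating`); `G` is adjoined as a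
finite-dimensional summand. -/

theorem toSchwartz_add (φ ψ : 𝓓(Ω, ℝ)) :
    toSchwartz (φ + ψ) = toSchwartz φ + toSchwartz ψ := by
  ext x
  change ((φ x + ψ x : ℝ) : ℂ) = (φ x : ℂ) + (ψ x : ℂ)
  push_cast
  rfl

theorem toSchwartz_smul (c : ℝ) (φ : 𝓓(Ω, ℝ)) :
    toSchwartz (c • φ) = c • toSchwartz φ := by
  ext x
  change ((c * φ x : ℝ) : ℂ) = c • (φ x : ℂ)
  simp

theorem norm_iteratedFDeriv_toSchwartz (φ : 𝓓(Ω, ℝ)) (j : ℕ) (x : Euc n) :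
    ‖iteratedFDeriv ℝ j (toSchwartz φ) x‖ = ‖iteratedFDeriv ℝ j φ x‖ :=
  Complex.ofRealLI.norm_iteratedFDeriv_comp_left (f := φ) (φ.contDiff.contDiffAt)
    (by exact_mod_cast le_top)

/-- Extension by zero embeds the test functions on `Ω` continuously into the Schwartz space. -/
def toSchwartzCLM : 𝓓(Ω, ℝ) →L[ℝ] 𝓢(Euc n, ℂ) :=
  TestFunction.mkCLM ℝ toSchwartz toSchwartz_add toSchwartz_smul (fun K hK ↦ by
    let Φ : 𝓓_{K}(Euc n, ℝ) →ₗ[ℝ] 𝓢(Euc n, ℂ) :=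
      { toFun := fun f ↦ toSchwartz (TestFunction.ofSupportedIn hK f)
        map_add' := fun f g ↦ toSchwartz_add (TestFunction.ofSupportedIn hK f)
          (TestFunction.ofSupportedIn hK g)
        map_smul' := fun c f ↦ toSchwartz_smul c (TestFunction.ofSupportedIn hK f) }
    change Continuous Φ
    refine WithSeminorms.continuous_of_isBounded
      (ContDiffMapSupportedIn.withSeminorms ℝ (Euc n) ℝ ⊤ K)
      (schwartz_withSeminorms ℝ (Euc n) ℂ) _ (.of_real fun m ↦ ?_)
    -- On `K` the weight is at most a power of the radius; off `K` all derivatives vanish. An empty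
    -- `K` may have `R < 0`, hence `max R 0`.
    obtain ⟨R, hR⟩ := K.isCompact.isBounded.exists_norm_le
    refine ⟨{m.2}, (max R 0) ^ m.1, fun f ↦ ?_⟩
    refine SchwartzMap.seminorm_le_bound ℝ m.1 m.2 _ (by positivity) fun x ↦ ?_
    change ‖x‖ ^ m.1 * ‖iteratedFDeriv ℝ m.2 (toSchwartz (TestFunction.ofSupportedIn hK f)) x‖ ≤ _
    rw [norm_iteratedFDeriv_toSchwartz]
    change ‖x‖ ^ m.1 * ‖iteratedFDeriv ℝ m.2 f x‖ ≤ _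
    by_cases hx : x ∈ K
    · gcongr
      · exact (hR x hx).trans (le_max_left _ _)
      · simpa using ContDiffMapSupportedIn.norm_iteratedFDeriv_apply_le_seminorm_top ℝ
    · rw [f.iteratedFDeriv_zero_on_compl hx]
      simp only [Pi.zero_apply, norm_zero, mul_zero]
      exact mul_nonneg (by positivity) (apply_nonneg _ _))

theorem continuous_besselPotential_apply (s : ℝ) (ψ : 𝓢(Euc n, ℂ)) :
    Continuous fun f : Lp ℂ 2 (volume : Measure (Euc n)) ↦
      besselPotential (Euc n) ℂ s (Lp.toTemperedDistributionCLM ℂ volume 2 f) ψ := by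
  have h : Continuous fun f : Lp ℂ 2 (volume : Measure (Euc n)) ↦
      besselPotential (Euc n) ℂ s (Lp.toTemperedDistributionCLM ℂ volume 2 f) := by
    fun_prop
  exact (PointwiseConvergenceCLM.evalCLM (RingHom.id ℂ) ℂ ψ).continuous.comp h

/-- The real part of the restriction of a tempered distribution to `Ω`. -/
def reRestrict : 𝓢'(Euc n, ℂ) →ₗ[ℝ] 𝓓'(Ω, ℝ) where
  toFun U :=
    { toFun := fun φ ↦ (U (toSchwartzCLM φ)).re
      map_add' := fun φ ψ ↦ by simp
      map_smul' := fun c φ ↦ by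
        rw [map_smul, ← Complex.coe_smul c (toSchwartzCLM φ), map_smul]
        simp
      cont := Complex.continuous_re.comp (U.continuous.comp toSchwartzCLM.continuous) }
  map_add' U V := by ext φ; exact Complex.add_re _ _
  map_smul' c U := by ext φ; exact Complex.smul_re _ _

theorem reRestrict_apply (U : 𝓢'(Euc n, ℂ)) (φ : 𝓓(Ω, ℝ)) :
    reRestrict U φ = (U (toSchwartz φ)).re := rfl

theorem RestrictsTo.reRestrict_eq {U : 𝓢'(Euc n, ℂ)} {T : 𝓓'(Ω, ℝ)} (h : RestrictsTo U T) :
    reRestrict U = T := by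
  ext φ
  rw [reRestrict_apply, h φ, Complex.ofReal_re]

theorem restrictsTo_reRestrict_iff {U : 𝓢'(Euc n, ℂ)} :
    RestrictsTo U (reRestrict U : 𝓓'(Ω, ℝ)) ↔ ∀ φ : 𝓓(Ω, ℝ), (U (toSchwartz φ)).im = 0 := by
  refine forall_congr' fun φ ↦ ?_
  rw [reRestrict_apply]
  constructor
  · intro h; rw [h]; simp
  · intro h; exact Complex.ext rfl (by simpa using h)

end Restriction

/-! ### Scalar Sobolev spaces as images of closed subspaces of `L²`. -/

section ScalarRepresentation

variable {n : ℕ} {Ω : Opens (Euc n)}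

variable (n) in
/-- The tempered distribution of order `s` on `ℝⁿ` whose Bessel potential is a given `L²`
function. -/
def ofBessel (s : ℝ) : Lp ℂ 2 (volume : Measure (Euc n)) →ₗ[ℝ] 𝓢'(Euc n, ℂ) :=
  ((besselPotential (Euc n) ℂ (-s)).toLinearMap.restrictScalars ℝ) ∘ₗ
    ((Lp.toTemperedDistributionCLM ℂ volume 2).toLinearMap.restrictScalars ℝ)

theorem besselPotential_eq_iff {s : ℝ} {U : 𝓢'(Euc n, ℂ)}
    {f : Lp ℂ 2 (volume : Measure (Euc n))} :
    besselPotential (Euc n) ℂ s U = (f : 𝓢'(Euc n, ℂ)) ↔ ofBessel n s f = U :=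
  (besselPotential_neg_apply_eq_iff s _ _).symm

theorem continuous_ofBessel_apply (s : ℝ) (ψ : 𝓢(Euc n, ℂ)) :
    Continuous fun f ↦ ofBessel n s f ψ :=
  continuous_besselPotential_apply (-s) ψ

variable (Ω) in
/-- The `L²` functions that are Bessel potentials of extensions of real distributions on `Ω`. -/
def realBessel (s : ℝ) : Submodule ℝ (Lp ℂ 2 (volume : Measure (Euc n))) where
  carrier := {f | ∀ φ : 𝓓(Ω, ℝ), (ofBessel n s f (toSchwartz φ)).im = 0}
  zero_mem' φ := by
    rw [map_zero]
    exact Complex.zero_im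
  add_mem' {f g} hf hg φ := by
    rw [map_add]
    exact (Complex.add_im _ _).trans ((congrArg₂ (· + ·) (hf φ) (hg φ)).trans (add_zero 0))
  smul_mem' c f hf φ := by
    rw [map_smul]
    exact (Complex.smul_im c (ofBessel n s f (toSchwartz φ))).trans
      ((congrArg (c • ·) (hf φ)).trans (smul_zero c))

theorem isClosed_realBessel (s : ℝ) :
    IsClosed (realBessel Ω s : Set (Lp ℂ 2 (volume : Measure (Euc n)))) := by
  have : (realBessel Ω s : Set (Lp ℂ 2 (volume : Measure (Euc n)))) =
      ⋂ φ : 𝓓(Ω, ℝ), {f | (ofBessel n s f (toSchwartz φ)).im = 0} := by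
    ext f
    simp only [Set.mem_iInter]
    rfl
  rw [this]
  exact isClosed_iInter fun φ ↦
    isClosed_eq (Complex.continuous_im.comp (continuous_ofBessel_apply s _)) continuous_const

instance (s : ℝ) : CompleteSpace (realBessel Ω s) := (isClosed_realBessel s).completeSpace_coe

variable (Ω) in
/-- The parametrization of the scalar Sobolev space `H^s(Ω)` by `L²` functions. -/
def scalarParam (s : ℝ) : realBessel Ω s →ₗ[ℝ] 𝓓'(Ω, ℝ) :=
  reRestrict ∘ₗ ofBessel n s ∘ₗ (realBessel Ω s).subtype

theorem restrictsTo_scalarParam (s : ℝ) (f : realBessel Ω s) :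
    RestrictsTo (ofBessel n s f) (scalarParam Ω s f) :=
  restrictsTo_reRestrict_iff.2 f.2

theorem continuous_scalarParam_apply (s : ℝ) (φ : 𝓓(Ω, ℝ)) :
    Continuous fun f ↦ scalarParam Ω s f φ :=
  Complex.continuous_re.comp
    ((continuous_ofBessel_apply s (toSchwartz φ)).comp continuous_subtype_val)

theorem scalarParam_mem (s : ℝ) (f : realBessel Ω s) : scalarParam Ω s f ∈ scalarSobolev Ω s :=
  ⟨ofBessel n s f, ⟨f, besselPotential_eq_iff.2 rfl⟩, restrictsTo_scalarParam s f⟩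

theorem RestrictsTo.exists_scalarParam_eq {s : ℝ} {U : 𝓢'(Euc n, ℂ)} {T : 𝓓'(Ω, ℝ)}
    (h : RestrictsTo U T) {f : Lp ℂ 2 (volume : Measure (Euc n))}
    (hf : besselPotential (Euc n) ℂ s U = (f : 𝓢'(Euc n, ℂ))) :
    ∃ g : realBessel Ω s, scalarParam Ω s g = T ∧ ‖g‖ = ‖f‖ := by
  obtain rfl := besselPotential_eq_iff.1 hf
  have hT := h.reRestrict_eq
  exact ⟨⟨f, restrictsTo_reRestrict_iff.1 (hT.symm ▸ h)⟩, hT, rfl⟩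

theorem scalarSobolevNorm_nonneg (s : ℝ) (T : 𝓓'(Ω, ℝ)) : 0 ≤ scalarSobolevNorm s T :=
  Real.sInf_nonneg (by rintro c ⟨U, f, -, -, rfl⟩; exact norm_nonneg f)

theorem scalarSobolevNorm_scalarParam_le (s : ℝ) (f : realBessel Ω s) :
    scalarSobolevNorm s (scalarParam Ω s f) ≤ ‖f‖ :=
  csInf_le ⟨0, by rintro c ⟨U, f, -, -, rfl⟩; exact norm_nonneg f⟩
    ⟨ofBessel n s f, f, restrictsTo_scalarParam s f, besselPotential_eq_iff.2 rfl, rfl⟩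

theorem exists_scalarParam_eq_norm_lt {s : ℝ} {T : 𝓓'(Ω, ℝ)} (hT : T ∈ scalarSobolev Ω s)
    {c : ℝ} (hc : scalarSobolevNorm s T < c) :
    ∃ g : realBessel Ω s, scalarParam Ω s g = T ∧ ‖g‖ < c := by
  obtain ⟨U, ⟨f, hf⟩, hU⟩ := hT
  -- Membership of `T` in `H^s` makes the set of extension norms nonempty, so its infimum is
  -- approached.
  obtain ⟨_, ⟨U', f', hU', hf', rfl⟩, hlt⟩ :=
    exists_lt_of_csInf_lt (by exact ⟨_, U, f, hU, hf, rfl⟩) hc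
  obtain ⟨g, hg, hgf⟩ := hU'.exists_scalarParam_eq hf'
  exact ⟨g, hg, hgf ▸ hlt⟩

/-- Extensions of `T` with norms tending to zero all take the value `T φ` at `φ`, while evaluation
is continuous in the parameter. -/
theorem eq_zero_of_scalarSobolevNorm_eq_zero {s : ℝ} {T : 𝓓'(Ω, ℝ)}
    (hT : T ∈ scalarSobolev Ω s) (h0 : scalarSobolevNorm s T = 0) : T = 0 := by
  have h (m : ℕ) := exists_scalarParam_eq_norm_lt hT
    (h0.trans_lt (Nat.one_div_pos_of_nat (α := ℝ) (n := m)))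
  choose g hg hlt using h
  have hlim : Filter.Tendsto g Filter.atTop (nhds 0) :=
    squeeze_zero_norm (fun m ↦ (hlt m).le) tendsto_one_div_add_atTop_nhds_zero_nat
  ext φ
  have h1 := ((continuous_scalarParam_apply s φ).tendsto 0).comp hlim
  have h2 : (fun f ↦ scalarParam Ω s f φ) ∘ g = fun _ ↦ T φ := funext fun m ↦ by
    simp only [Function.comp_apply, hg]
  rw [h2, map_zero] at h1
  exact tendsto_nhds_unique tendsto_const_nhds h1

/-- The factor 2 avoids showing that the infimum is attained; it gives room only if the norm is
positive, so norm zero is treated separately. -/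
theorem exists_scalarParam_eq_norm_le {s : ℝ} {T : 𝓓'(Ω, ℝ)} (hT : T ∈ scalarSobolev Ω s) :
    ∃ g : realBessel Ω s, scalarParam Ω s g = T ∧ ‖g‖ ≤ 2 * scalarSobolevNorm s T := by
  rcases (scalarSobolevNorm_nonneg s T).eq_or_lt with h | h
  · exact ⟨0, by rw [map_zero, eq_zero_of_scalarSobolevNorm_eq_zero hT h.symm], by simp [← h]⟩
  · obtain ⟨g, hg, hlt⟩ := exists_scalarParam_eq_norm_lt hT (lt_two_mul_self h)
    exact ⟨g, hg, hlt.le⟩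

theorem scalarSobolev_antitone : Antitone (scalarSobolev Ω) := by
  rintro s t hst T ⟨U, hU, hT⟩
  exact ⟨U, hU.mono hst, hT⟩

end ScalarRepresentation

/-! ### Vector-valued Sobolev spaces, parametrized in an orthonormal basis. -/

section VectorRepresentation

variable {n : ℕ} {Ω : Opens (Euc n)}
  {W : Type*} [NormedAddCommGroup W] [InnerProductSpace ℝ W]

theorem mem_sobolev_iff {s : ℝ} {T : 𝓓'(Ω, W)} :
    T ∈ Sobolev Ω W s ↔ ∀ w, component w T ∈ scalarSobolev Ω s := by
  simp [Sobolev, Submodule.mem_iInf]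

theorem component_apply (w : W) (T : 𝓓'(Ω, W)) (φ : 𝓓(Ω, ℝ)) :
    component w T φ = inner ℝ w (T φ) := rfl

theorem sobolev_antitone : Antitone (Sobolev Ω W) := fun _ _ hst _ hT ↦
  mem_sobolev_iff.2 fun w ↦ scalarSobolev_antitone hst (mem_sobolev_iff.1 hT w)

theorem sum_distribution_apply {F ι : Type*} [NormedAddCommGroup F] [NormedSpace ℝ F]
    (t : Finset ι) (T : ι → 𝓓'(Ω, F)) (φ : 𝓓(Ω, ℝ)) : (∑ i ∈ t, T i) φ = ∑ i ∈ t, T i φ :=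
  map_sum (⟨⟨fun S : 𝓓'(Ω, F) ↦ S φ, rfl⟩, fun _ _ ↦ rfl⟩ : 𝓓'(Ω, F) →+ F) T t

variable [FiniteDimensional ℝ W]

theorem sobolevNorm_nonneg (s : ℝ) (T : 𝓓'(Ω, W)) : 0 ≤ sobolevNorm s T := Real.sqrt_nonneg _

variable (Ω W) in
/-- The tuples of `L²` functions that parametrize `H^s(Ω) ⊗ W`. -/
def ParamSpace (s : ℝ) : Type := Fin (Module.finrank ℝ W) → realBessel Ω s

instance (s : ℝ) : NormedAddCommGroup (ParamSpace Ω W s) :=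
  inferInstanceAs (NormedAddCommGroup (Fin (Module.finrank ℝ W) → realBessel Ω s))

instance (s : ℝ) : NormedSpace ℝ (ParamSpace Ω W s) :=
  inferInstanceAs (NormedSpace ℝ (Fin (Module.finrank ℝ W) → realBessel Ω s))

instance (s : ℝ) : CompleteSpace (ParamSpace Ω W s) :=
  inferInstanceAs (CompleteSpace (Fin (Module.finrank ℝ W) → realBessel Ω s))

variable (Ω W) in
/-- The coordinates of a tuple of `L²` functions. -/
def ParamSpace.proj (s : ℝ) (i : Fin (Module.finrank ℝ W)) :
    ParamSpace Ω W s →L[ℝ] realBessel Ω s :=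
  ContinuousLinearMap.proj (φ := fun _ : Fin (Module.finrank ℝ W) ↦ realBessel Ω s) i

variable (Ω W) in
/-- The parametrization of `H^s(Ω) ⊗ W` by tuples of `L²` functions. -/
def param (s : ℝ) : ParamSpace Ω W s →ₗ[ℝ] 𝓓'(Ω, W) :=
  ∑ i, (Distribution.mapCLM
    (ContinuousLinearMap.toSpanSingleton ℝ (stdOrthonormalBasis ℝ W i))).toLinearMap ∘ₗ
      scalarParam Ω s ∘ₗ (ParamSpace.proj Ω W s i).toLinearMap

theorem param_apply (s : ℝ) (f : ParamSpace Ω W s) (φ : 𝓓(Ω, ℝ)) :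
    param Ω W s f φ = ∑ i, scalarParam Ω s (f i) φ • stdOrthonormalBasis ℝ W i := by
  rw [param, LinearMap.sum_apply, sum_distribution_apply]
  rfl

theorem continuous_param_apply (s : ℝ) (φ : 𝓓(Ω, ℝ)) :
    Continuous fun f ↦ param Ω W s f φ := by
  simp only [param_apply]
  exact continuous_finsetSum _ fun i _ ↦
    ((continuous_scalarParam_apply s φ).comp (ParamSpace.proj Ω W s i).continuous).smul
      continuous_const

theorem component_param (s : ℝ) (f : ParamSpace Ω W s) (w : W) :
    component w (param Ω W s f) =
      ∑ i, inner ℝ w (stdOrthonormalBasis ℝ W i) • scalarParam Ω s (f i) := by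
  ext φ
  rw [component_apply, param_apply, sum_distribution_apply, inner_sum]
  refine Finset.sum_congr rfl fun i _ ↦ ?_
  rw [inner_smul_right, mul_comm]
  rfl

theorem component_basis_param (s : ℝ) (f : ParamSpace Ω W s)
    (i : Fin (Module.finrank ℝ W)) :
    component (stdOrthonormalBasis ℝ W i) (param Ω W s f) = scalarParam Ω s (f i) := by
  rw [component_param, Finset.sum_eq_single i]
  · simp
  · intro j _ hj
    rw [(stdOrthonormalBasis ℝ W).inner_eq_zero hj.symm, zero_smul]
  · simp

theorem param_mem (s : ℝ) (f : ParamSpace Ω W s) :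
    param Ω W s f ∈ Sobolev Ω W s :=
  mem_sobolev_iff.2 fun w ↦ by
    rw [component_param]
    exact Submodule.sum_mem _ fun i _ ↦ Submodule.smul_mem _ _ (scalarParam_mem s (f i))

/-- The tuples carry the sup norm, and passing to the Euclidean norm costs the root of the
dimension. -/
theorem sobolevNorm_param_le (s : ℝ) (f : ParamSpace Ω W s) :
    sobolevNorm s (param Ω W s f) ≤ √(Module.finrank ℝ W) * ‖f‖ := by
  rw [sobolevNorm, Real.sqrt_le_left (by positivity), mul_pow, Real.sq_sqrt (by positivity)]
  refine (Finset.sum_le_card_nsmul _ _ (‖f‖ ^ 2) fun i _ ↦ ?_).trans (by simp)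
  rw [component_basis_param]
  exact pow_le_pow_left₀ (scalarSobolevNorm_nonneg s _)
    ((scalarSobolevNorm_scalarParam_le s (f i)).trans
      (norm_le_pi_norm (G := fun _ ↦ realBessel Ω s) f i)) 2

theorem scalarSobolevNorm_component_le (s : ℝ) (T : 𝓓'(Ω, W)) (i : Fin (Module.finrank ℝ W)) :
    scalarSobolevNorm s (component (stdOrthonormalBasis ℝ W i) T) ≤ sobolevNorm s T :=
  Real.le_sqrt_of_sq_le (Finset.single_le_sum
    (f := fun i ↦ scalarSobolevNorm s (component (stdOrthonormalBasis ℝ W i) T) ^ 2)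
    (fun _ _ ↦ sq_nonneg _) (Finset.mem_univ i))

theorem exists_param_eq_norm_le {s : ℝ} {T : 𝓓'(Ω, W)} (hT : T ∈ Sobolev Ω W s) :
    ∃ f, param Ω W s f = T ∧ ‖f‖ ≤ 2 * sobolevNorm s T := by
  have h (i) := exists_scalarParam_eq_norm_le
    (mem_sobolev_iff.1 hT (stdOrthonormalBasis ℝ W i))
  choose f₀ hf hle using h
  obtain ⟨f, rfl⟩ : ∃ f : ParamSpace Ω W s, (fun i ↦ f i) = f₀ := ⟨f₀, rfl⟩
  refine ⟨f, ?_, ?_⟩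
  · ext φ
    rw [param_apply]
    simp only [hf, component_apply]
    exact (stdOrthonormalBasis ℝ W).sum_repr' (T φ)
  · refine (pi_norm_le_iff_of_nonneg (x := fun i ↦ f i)
      (mul_nonneg zero_le_two (sobolevNorm_nonneg s T))).2
      fun i ↦ (hle i).trans ?_
    exact mul_le_mul_of_nonneg_left (scalarSobolevNorm_component_le s T i) zero_le_two

end VectorRepresentation

/-! ### Weak continuity of differential operators. -/

section WeakContinuity

variable {n : ℕ} {Ω : Opens (Euc n)}
  {F : Type*} [NormedAddCommGroup F] [NormedSpace ℝ F]
  {F' : Type*} [NormedAddCommGroup F'] [NormedSpace ℝ F']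

theorem continuous_iteratedLineDerivOp_apply {X : Type*} [TopologicalSpace X]
    {S : X → 𝓓'(Ω, F)} (hS : ∀ φ, Continuous fun x ↦ S x φ) {j : ℕ} (m : Fin j → Euc n)
    (φ : 𝓓(Ω, ℝ)) : Continuous fun x ↦ (∂^{m} (S x)) φ := by
  induction j generalizing φ with
  | zero => simpa using hS φ
  | succ j ih =>
    simp only [LineDeriv.iteratedLineDerivOp_succ_left, Distribution.lineDerivOp_apply_apply]
    exact ih _ _

/-- Derivatives and coefficients are moved onto the test function, so each term is again an
evaluation of `S x`, up to sign and a continuous linear map. -/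
theorem IsDiffOp.continuous_apply {γ : ℝ} {D : 𝓓'(Ω, F) →ₗ[ℝ] 𝓓'(Ω, F')} (hD : IsDiffOp γ D)
    {X : Type*} [TopologicalSpace X] {S : X → 𝓓'(Ω, F)}
    (hS : ∀ φ, Continuous fun x ↦ S x φ) (φ : 𝓓(Ω, ℝ)) : Continuous fun x ↦ D (S x) φ := by
  induction hD using Submodule.span_induction with
  | mem L hL =>
    obtain ⟨j, m, c, hc, A, -, hL⟩ := hL
    simp only [hL]
    exact A.continuous.comp (continuous_iteratedLineDerivOp_apply hS m (mulTest c hc φ))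
  | zero => exact continuous_const
  | add L L' _ _ h h' => exact h.add h'
  | smul c L _ h => exact h.const_smul c

end WeakContinuity

/-! ### Open mapping theorem without a Banach structure on the target. -/

section OpenMapping

variable {X Y V F ι : Type*}
  [NormedAddCommGroup X] [NormedSpace ℝ X] [CompleteSpace X]
  [NormedAddCommGroup Y] [NormedSpace ℝ Y] [CompleteSpace Y] [AddCommGroup V] [Module ℝ V]

/-- An open mapping theorem for maps of Banach spaces into a vector space `V` that are continuous
after composition with a separating family of linear maps on `V`. -/
theorem exists_preimage_norm_le_of_separating
    [TopologicalSpace F] [AddCommGroup F] [Module ℝ F] [T2Space F]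
    (ev : ι → V →ₗ[ℝ] F) (hev : ∀ v, (∀ i, ev i v = 0) → v = 0)
    (P : X →ₗ[ℝ] V) (Q : Y →ₗ[ℝ] V)
    (hP : ∀ i, Continuous fun x ↦ ev i (P x)) (hQ : ∀ i, Continuous fun y ↦ ev i (Q y))
    (h : ∀ y, ∃ x, P x = Q y) :
    ∃ C : ℝ, 0 < C ∧ ∀ y, ∃ x, P x = Q y ∧ ‖x‖ ≤ C * ‖y‖ := by
  -- The fibre product of `P` and `Q` is closed because the maps `ev i` separate points; the open
  -- mapping theorem applies to its projection to `Y`.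
  let H : Submodule ℝ (X × Y) :=
    LinearMap.eqLocus (P ∘ₗ LinearMap.fst ℝ X Y) (Q ∘ₗ LinearMap.snd ℝ X Y)
  have hH : IsClosed (H : Set (X × Y)) := by
    have : (H : Set (X × Y)) = ⋂ i, {p | ev i (P p.1) = ev i (Q p.2)} := by
      ext p
      simp only [Set.mem_iInter, Set.mem_ofPred_eq]
      change P p.1 = Q p.2 ↔ _
      refine ⟨fun h i ↦ by rw [h], fun h ↦ sub_eq_zero.mp (hev _ fun i ↦ ?_)⟩
      rw [map_sub, h, sub_self]
    rw [this]
    exact isClosed_iInter fun i ↦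
      isClosed_eq ((hP i).comp continuous_fst) ((hQ i).comp continuous_snd)
  have : CompleteSpace H := hH.completeSpace_coe
  let π : H →L[ℝ] Y := (ContinuousLinearMap.snd ℝ X Y).comp H.subtypeL
  have hπ : Function.Surjective π := fun y ↦ by
    obtain ⟨x, hx⟩ := h y
    exact ⟨⟨(x, y), hx⟩, rfl⟩
  obtain ⟨C, hC, hb⟩ := π.exists_preimage_norm_le hπ
  refine ⟨C, hC, fun y ↦ ?_⟩
  obtain ⟨⟨⟨x, y'⟩, hxy⟩, rfl, hle⟩ := hb y
  exact ⟨x, hxy, (norm_fst_le _).trans hle⟩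

/-- If a closed subspace `K` of `Y` is mapped by `Q` into the sum of the range of `P` and a finite
dimensional space `G`, then the solutions of `P x = Q y` modulo `G` can be chosen with a bound. -/
theorem exists_sub_mem_norm_le_of_separating
    [NormedAddCommGroup F] [NormedSpace ℝ F]
    (ev : ι → V →ₗ[ℝ] F) (hev : ∀ v, (∀ i, ev i v = 0) → v = 0)
    (P : X →ₗ[ℝ] V) (Q : Y →ₗ[ℝ] V)
    (hP : ∀ i, Continuous fun x ↦ ev i (P x)) (hQ : ∀ i, Continuous fun y ↦ ev i (Q y))
    (G : Submodule ℝ V) [FiniteDimensional ℝ G] {K : Submodule ℝ Y}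
    (hK : IsClosed (K : Set Y)) (h : ∀ y ∈ K, Q y ∈ LinearMap.range P ⊔ G) :
    ∃ C : ℝ, 0 < C ∧ ∀ y ∈ K, ∃ x, Q y - P x ∈ G ∧ ‖x‖ ≤ C * ‖y‖ := by
  -- Coordinates on `G` give a Banach space whose linear maps to `F` are automatically continuous.
  let N : (Fin (Module.finrank ℝ G) → ℝ) →ₗ[ℝ] V :=
    G.subtype ∘ₗ (Module.finBasis ℝ G).equivFun.symm.toLinearMap
  have : CompleteSpace K := hK.completeSpace_coe
  obtain ⟨C, hC, hb⟩ := exists_preimage_norm_le_of_separating ev hev (P.coprod N)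
    (Q ∘ₗ K.subtype)
    (fun i ↦ by
      have h2 : Continuous (ev i ∘ₗ N) := LinearMap.continuous_of_finiteDimensional _
      simp only [LinearMap.coprod_apply, map_add]
      exact ((hP i).comp continuous_fst).add (h2.comp continuous_snd))
    (fun i ↦ (hQ i).comp continuous_subtype_val)
    (by
      rintro ⟨y, hy⟩
      obtain ⟨_, ⟨x, rfl⟩, g, hg, hsum⟩ := Submodule.mem_sup.1 (h y hy)
      exact ⟨(x, (Module.finBasis ℝ G).equivFun ⟨g, hg⟩), by simpa [N] using hsum⟩)
  refine ⟨C, hC, fun y hy ↦ ?_⟩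
  obtain ⟨⟨x, z⟩, hxz, hle⟩ := hb ⟨y, hy⟩
  refine ⟨x, ?_, (norm_fst_le _).trans hle⟩
  have h : P x + N z = Q y := by simpa using hxz
  rw [← h, add_sub_cancel_left]
  exact Subtype.coe_prop ((Module.finBasis ℝ G).equivFun.symm z)

/-- The case of distribution valued maps that are continuous after evaluation at test functions. -/
theorem exists_sub_mem_norm_le {n : ℕ} {Ω : Opens (Euc n)}
    [NormedAddCommGroup F] [NormedSpace ℝ F]
    (P : X →ₗ[ℝ] 𝓓'(Ω, F)) (Q : Y →ₗ[ℝ] 𝓓'(Ω, F))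
    (hP : ∀ φ, Continuous fun x ↦ P x φ) (hQ : ∀ φ, Continuous fun y ↦ Q y φ)
    (G : Submodule ℝ 𝓓'(Ω, F)) [FiniteDimensional ℝ G] {K : Submodule ℝ Y}
    (hK : IsClosed (K : Set Y)) (h : ∀ y ∈ K, Q y ∈ LinearMap.range P ⊔ G) :
    ∃ C : ℝ, 0 < C ∧ ∀ y ∈ K, ∃ x, Q y - P x ∈ G ∧ ‖x‖ ≤ C * ‖y‖ :=
  exists_sub_mem_norm_le_of_separating
    (fun φ : 𝓓(Ω, ℝ) ↦ (⟨⟨fun T ↦ T φ, fun _ _ ↦ rfl⟩, fun _ _ ↦ rfl⟩ : 𝓓'(Ω, F) →ₗ[ℝ] F))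
    (fun _ hv ↦ ContinuousLinearMap.ext hv) P Q hP hQ G hK h

end OpenMapping

/-! ### Bounded preimages in the Sobolev scale. -/

section Regularity

theorem IsDiffOp.isClosed_ker_comp_param {n : ℕ} {Ω : Opens (Euc n)}
    {V : Type*} [NormedAddCommGroup V] [InnerProductSpace ℝ V] [FiniteDimensional ℝ V]
    {F : Type*} [NormedAddCommGroup F] [NormedSpace ℝ F]
    {c : ℝ} {L : 𝓓'(Ω, V) →ₗ[ℝ] 𝓓'(Ω, F)} (hL : IsDiffOp c L) (s : ℝ) :
    IsClosed (LinearMap.ker (L ∘ₗ param Ω V s) :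
      Set (ParamSpace Ω V s)) := by
  have : (LinearMap.ker (L ∘ₗ param Ω V s) :
      Set (ParamSpace Ω V s)) =
      ⋂ φ : 𝓓(Ω, ℝ), {f | L (param Ω V s f) φ = 0} := by
    ext f
    simp only [Set.mem_iInter]
    exact ⟨fun h φ ↦ congrArg (fun T : 𝓓'(Ω, F) ↦ T φ) h, fun h ↦ ContinuousLinearMap.ext h⟩
  rw [this]
  exact isClosed_iInter fun φ ↦ isClosed_eq
    (hL.continuous_apply (continuous_param_apply s) φ) continuous_const


theorem order_eq_add (γ : ℤ → ℝ) (q : ℝ) (k : ℤ) : order γ q k = q + order γ 0 k := by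
  simp only [order]
  ring

/-- Every real number is the order in degree `k` of some complex of the scale, so the hypotheses
apply at any prescribed order. -/
theorem exists_order_eq (γ : ℤ → ℝ) (s : ℝ) (k : ℤ) : ∃ q, order γ q k = s :=
  ⟨s - order γ 0 k, by rw [order_eq_add, sub_add_cancel]⟩

variable {n : ℕ} {Ω : Opens (Euc n)} {W : ℤ → Type*} [∀ k, NormedAddCommGroup (W k)]
  [∀ k, InnerProductSpace ℝ (W k)] {γ : ℤ → ℝ}
  {D : ∀ k, 𝓓'(Ω, W k) →ₗ[ℝ] 𝓓'(Ω, W (k + 1))}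

theorem IsSobolevScale.comp_eq_zero (hD : IsSobolevScale Ω W γ D) {s : ℝ} {k : ℤ}
    {u : 𝓓'(Ω, W k)} (hu : u ∈ Sobolev Ω (W k) s) : D (k + 1) (D k u) = 0 := by
  obtain ⟨q, rfl⟩ := exists_order_eq γ s k
  exact hD.complex q k u hu

variable {G : ∀ k, Submodule ℝ 𝓓'(Ω, W k)}

theorem UniformlyRepresentsCohomology.disjoint_map
    (hG : UniformlyRepresentsCohomology Ω W γ D G) (s : ℝ) (k : ℤ) :
    Disjoint ((Sobolev Ω (W k) s).map (D k)) (G (k + 1)) := by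
  obtain ⟨q, rfl⟩ := exists_order_eq γ s k
  exact hG.disjoint q k

theorem UniformlyRepresentsCohomology.inf_ker_eq
    (hG : UniformlyRepresentsCohomology Ω W γ D G) (s : ℝ) (k : ℤ) :
    Sobolev Ω (W (k + 1)) s ⊓ LinearMap.ker (D (k + 1)) =
      (Sobolev Ω (W k) (s + γ k)).map (D k) ⊔ G (k + 1) := by
  obtain ⟨q, rfl⟩ := exists_order_eq γ s (k + 1)
  have h := hG.ker_eq q k
  rwa [show order γ q k = order γ q (k + 1) + γ k by rw [order_succ]; ring] at h

variable [∀ k, FiniteDimensional ℝ (W k)]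

/-- Closed elements of order `s` are, up to a cohomology representative, images of elements of
order `s + γ_k`, with a bound on the preimage. -/
theorem UniformlyRepresentsCohomology.exists_preimage_norm_le
    (hD : IsSobolevScale Ω W γ D) (hG : UniformlyRepresentsCohomology Ω W γ D G)
    (s : ℝ) (k : ℤ) :
    ∃ C : ℝ, 0 < C ∧ ∀ v ∈ Sobolev Ω (W (k + 1)) s, D (k + 1) v = 0 →
      ∃ u ∈ Sobolev Ω (W k) (s + γ k), v - D k u ∈ G (k + 1) ∧
        sobolevNorm (s + γ k) u ≤ C * sobolevNorm s v := by
  have := hG.finiteDimensional (k + 1)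
  have hmem (y) (hy : y ∈ LinearMap.ker (D (k + 1) ∘ₗ param Ω (W (k + 1)) s)) :
      param Ω (W (k + 1)) s y ∈
        LinearMap.range (D k ∘ₗ param Ω (W k) (s + γ k)) ⊔ G (k + 1) := by
    have h : param Ω (W (k + 1)) s y ∈
        Sobolev Ω (W (k + 1)) s ⊓ LinearMap.ker (D (k + 1)) := ⟨param_mem s y, hy⟩
    rw [hG.inf_ker_eq] at h
    have hle : (Sobolev Ω (W k) (s + γ k)).map (D k) ≤
        LinearMap.range (D k ∘ₗ param Ω (W k) (s + γ k)) := by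
      rintro _ ⟨u, hu, rfl⟩
      obtain ⟨x, rfl, -⟩ := exists_param_eq_norm_le hu
      exact ⟨x, rfl⟩
    exact (sup_le_sup_right hle (G (k + 1)) :) h
  have hP (φ : 𝓓(Ω, ℝ)) : Continuous fun x ↦ (D k ∘ₗ param Ω (W k) (s + γ k)) x φ :=
    (hD.isDiffOp k).continuous_apply (continuous_param_apply (s + γ k)) φ
  have hK := (hD.isDiffOp (k + 1)).isClosed_ker_comp_param s
  obtain ⟨C, hC, hb⟩ := exists_sub_mem_norm_le (D k ∘ₗ param Ω (W k) (s + γ k))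
    (param Ω (W (k + 1)) s) hP (continuous_param_apply s) (G (k + 1)) hK hmem
  -- The root compares the sup and Hilbert norms, `C` is the open mapping constant, 2 comes from the
  -- near-optimal parameter of `v`, and `+ 1` keeps the constant positive when `W k` is zero.
  refine ⟨√(Module.finrank ℝ (W k)) * (C * 2) + 1, by positivity, fun v hv hv0 ↦ ?_⟩
  obtain ⟨y, rfl, hy⟩ := exists_param_eq_norm_le hv
  obtain ⟨x, hxG, hle⟩ := hb y hv0
  refine ⟨param Ω (W k) (s + γ k) x, param_mem _ x, hxG, ?_⟩
  have hx : ‖x‖ ≤ C * (2 * sobolevNorm s (param Ω (W (k + 1)) s y)) :=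
    hle.trans (mul_le_mul_of_nonneg_left hy hC.le)
  have h := (sobolevNorm_param_le (s + γ k) x).trans
    (mul_le_mul_of_nonneg_left hx (Real.sqrt_nonneg _))
  linarith [sobolevNorm_nonneg s (param Ω (W (k + 1)) s y)]

end Regularity

end SobolevScale

end

theorem mainTheorem6 {n : ℕ} (Ω : Opens (SobolevScale.Euc n))
    (hΩ : SobolevScale.IsBoundedLipschitzDomain Ω)
    (W : ℤ → Type*) [∀ k, NormedAddCommGroup (W k)] [∀ k, InnerProductSpace ℝ (W k)]
    [∀ k, FiniteDimensional ℝ (W k)]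
    (γ : ℤ → ℝ) (D : ∀ k, 𝓓'(Ω, W k) →ₗ[ℝ] 𝓓'(Ω, W (k + 1)))
    (hD : SobolevScale.IsSobolevScale Ω W γ D)
    (hG : ∃ G, SobolevScale.UniformlyRepresentsCohomology Ω W γ D G)
    (q r : ℝ) (k : ℤ) :
    ∃ C : ℝ, ∀ v ∈ SobolevScale.Sobolev Ω (W (k + 1)) q ⊓
        (SobolevScale.Sobolev Ω (W k) r).map (D k),
      ∃ u ∈ SobolevScale.Sobolev Ω (W k) (q + γ k), D k u = v ∧
        SobolevScale.sobolevNorm (q + γ k) u ≤ C * SobolevScale.sobolevNorm q v := by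
  obtain ⟨G, hG⟩ := hG
  obtain ⟨C, -, hC⟩ := hG.exists_preimage_norm_le hD q k
  refine ⟨C, ?_⟩
  rintro _ ⟨hv, w, hw, rfl⟩
  obtain ⟨u, hu, huG, hle⟩ := hC _ hv (hD.comp_eq_zero hw)
  refine ⟨u, hu, ?_, hle⟩
  -- The minimum is an order common to `w` and `u`, so the defect `D w - D u`, known to lie in `G`,
  -- is exact at that order.
  have hmem : D k w - D k u ∈ (SobolevScale.Sobolev Ω (W k) (min r (q + γ k))).map (D k) :=
    ⟨w - u, Submodule.sub_mem _ (SobolevScale.sobolev_antitone (min_le_left _ _) hw)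
      (SobolevScale.sobolev_antitone (min_le_right _ _) hu), map_sub _ _ _⟩
  exact (sub_eq_zero.1
    (Submodule.disjoint_def.1 (hG.disjoint_map (min r (q + γ k)) k) _ hmem huG)).symm
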